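/- \textbf{Theorem (Termination).} Let $\mathcal S$ be a field. Propositions are given by $A ::= \top \mid \bot \mid A\Rightarrow A \mid A\wedge A \mid A\vee A$, and proof-terms (considered modulo $\alpha$-equivalence) by $$t ::= x \mid t + t \mid a\bullet t \mid a.\star \mid \delta_\top(t,t) \mid \delta_\bot(t) \mid \lambda x.t \mid t\,t \mid \langle t,t\rangle \mid \delta^1_\wedge(t,x.t) \mid \delta^2_\wedge(t,x.t) \mid \mathrm{inl}(t)\mid \mathrm{inr}(t)\mid \delta_\vee(t,x.t,y.t)$$ with $a\in\mathcal S$. Contexts are finite sets of declarations $x:A$ of distinct variables, and $\Gamma,\Delta$ denotes a disjoint union. The typing judgement $\Gamma\vdash t:A$ of the ${\mathcal L}^{\mathcal S}$-calculus is inductively defined by the rules: \begin{itemize} \item $x:A\vdash x:A$; and $\vdash a.\star:\top$ for $a\in\mathcal S$; \item if $\Gamma\vdash t:A$ and $\Gamma\vdash u:A$, then $\Gamma\vdash t+u:A$; if $\Gamma\vdash t:A$, then $\Gamma\vdash a\bullet t:A$ for $a\in\mathcal S$; \item if $\Gamma\vdash t:\top$ and $\Delta\vdash u:A$, then $\Gamma,\Delta\vdash\delta_\top(t,u):A$;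 if $\Gamma\vdash t:\bot$, then $\Gamma,\Delta\vdash\delta_\bot(t):C$; \item if $\Gamma,x:A\vdash t:B$, then $\Gamma\vdash\lambda x.t:A\Rightarrow B$; if $\Gamma\vdash t:A\Rightarrow B$ and $\Delta\vdash u:A$, then $\Gamma,\Delta\vdash t\,u:B$; \item if $\Gamma\vdash t:A$ and $\Gamma\vdash u:B$, then $\Gamma\vdash\langle t,u\rangle:A\wedge B$; if $\Gamma\vdash t:A\wedge B$ and $\Delta,x:A\vdash u:C$ (respectively $\Delta,x:B\vdash u:C$), then $\Gamma,\Delta\vdash\delta^1_\wedge(t,x.u):C$ (respectively $\Gamma,\Delta\vdash\delta^2_\wedge(t,x.u):C$); \item if $\Gamma\vdash t:A$, then $\Gamma\vdash\mathrm{inl}(t):A\vee B$; if $\Gamma\vdash t:B$, then $\Gamma\vdash\mathrm{inr}(t):A\vee B$; if $\Gamma\vdash t:A\vee B$, $\Delta,x:A\vdash u:C$ and $\Delta,y:B\vdash v:C$, then $\Gamma,\Delta\vdash\delta_\vee(t,x.u,y.v):C$. \end{itemize} The one-step reduction relation $\longrightarrow$ is the closure under all term constructors (including below binders) of the rules $$\begin{array}{ll}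 \delta_\top(a.\star,t)\longrightarrow a\bullet t, & (\lambda x.t)\,u\longrightarrow (u/x)t,\\ \delta^1_\wedge(\langle t,u\rangle,x.v)\longrightarrow (t/x)v, & \delta^2_\wedge(\langle t,u\rangle,x.v)\longrightarrow (u/x)v,\\ \delta_\vee(\mathrm{inl}(t),x.v,y.w)\longrightarrow (t/x)v, & \delta_\vee(\mathrm{inr}(u),x.v,y.w)\longrightarrow (u/y)w,\\ a.\star+b.\star\longrightarrow (a+b).\star, & a\bullet b.\star\longrightarrow (a\times b).\star,\\ (\lambda x.t)+(\lambda x.u)\longrightarrow\lambda x.(t+u), & a\bullet\lambda x.t\longrightarrow\lambda x.(a\bullet t),\\ \langle t,u\rangle+\langle v,w\rangle\longrightarrow\langle t+v,u+w\rangle, & a\bullet\langle t,u\rangle\longrightarrow\langle a\bullet t,a\bullet u\rangle,\\ \delta_\vee(t+u,x.v,y.w)\longrightarrow\delta_\vee(t,x.v,y.w)+\delta_\vee(u,x.v,y.w), & \delta_\vee(a\bullet t,x.v,y.w)\longrightarrow a\bullet\delta_\vee(t,x.v,y.w), \end{array}$$ where $(u/x)t$ is capture-avoiding substitution. Then the ${\mathcal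 L}^{\mathcal S}$-calculus is strongly normalizing: whenever $\Gamma\vdash t:A$, there is no infinite reduction sequence $t=t_0\longrightarrow t_1\longrightarrow t_2\longrightarrow\cdots$. -/

import Mathlib

namespace LSCalculus

/-- Propositions: `A = ⊤ | ⊥ | A ⇒ A | A ∧ A | A ∨ A`. -/
inductive Proposition : Type
  | top : Proposition
  | bot : Proposition
  | imp (A B : Proposition) : Proposition
  | and (A B : Proposition) : Proposition
  | or (A B : Proposition) : Proposition

/-- Proof-terms modulo α-equivalence, in de Bruijn notation: `var n` refers to the `n`-th enclosing
binder (counted from the inside, starting at `0`), or to a free variable when there are at most `n`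
enclosing binders.  `lam` binds one variable in its argument, `elimAnd1` and `elimAnd2` bind one
variable in their second argument, and `elimOr` binds one variable in its second argument and one
in its third. -/
inductive Term (S : Type*) : Type _
  | var (n : ℕ) : Term S
  | plus (t u : Term S) : Term S
  | smul (a : S) (t : Term S) : Term S
  | star (a : S) : Term S
  | elimTop (t u : Term S) : Term S
  | elimBot (t : Term S) : Term S
  | lam (t : Term S) : Term S
  | app (t u : Term S) : Term S
  | pair (t u : Term S) : Term S
  | elimAnd1 (t u : Term S) : Term S
  | elimAnd2 (t u : Term S) : Term S
  | inl (t : Term S) : Term S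
  | inr (t : Term S) : Term S
  | elimOr (t u v : Term S) : Term S

namespace Term

variable {S : Type*}

/-- The action of a renaming `ξ` on the variables below one more binder. -/
def liftRen (ξ : ℕ → ℕ) : ℕ → ℕ
  | 0 => 0
  | n + 1 => ξ n + 1

/-- Capture-avoiding renaming of the free variables. -/
def rename : (ℕ → ℕ) → Term S → Term S
  | ξ, var n => var (ξ n)
  | ξ, plus t u => plus (rename ξ t) (rename ξ u)
  | ξ, smul a t => smul a (rename ξ t)
  | _, star a => star a
  | ξ, elimTop t u => elimTop (rename ξ t) (rename ξ u)
  | ξ, elimBot t => elimBot (rename ξ t)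
  | ξ, lam t => lam (rename (liftRen ξ) t)
  | ξ, app t u => app (rename ξ t) (rename ξ u)
  | ξ, pair t u => pair (rename ξ t) (rename ξ u)
  | ξ, elimAnd1 t u => elimAnd1 (rename ξ t) (rename (liftRen ξ) u)
  | ξ, elimAnd2 t u => elimAnd2 (rename ξ t) (rename (liftRen ξ) u)
  | ξ, inl t => inl (rename ξ t)
  | ξ, inr t => inr (rename ξ t)
  | ξ, elimOr t u v => elimOr (rename ξ t) (rename (liftRen ξ) u) (rename (liftRen ξ) v)

/-- The action of a substitution `σ` on the variables below one more binder. -/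
def liftSubst (σ : ℕ → Term S) : ℕ → Term S
  | 0 => var 0
  | n + 1 => rename Nat.succ (σ n)

/-- Simultaneous capture-avoiding substitution of `σ n` for each free variable `n`. -/
def subst : (ℕ → Term S) → Term S → Term S
  | σ, var n => σ n
  | σ, plus t u => plus (subst σ t) (subst σ u)
  | σ, smul a t => smul a (subst σ t)
  | _, star a => star a
  | σ, elimTop t u => elimTop (subst σ t) (subst σ u)
  | σ, elimBot t => elimBot (subst σ t)
  | σ, lam t => lam (subst (liftSubst σ) t)
  | σ, app t u => app (subst σ t) (subst σ u)
  | σ, pair t u => pair (subst σ t) (subst σ u)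
  | σ, elimAnd1 t u => elimAnd1 (subst σ t) (subst (liftSubst σ) u)
  | σ, elimAnd2 t u => elimAnd2 (subst σ t) (subst (liftSubst σ) u)
  | σ, inl t => inl (subst σ t)
  | σ, inr t => inr (subst σ t)
  | σ, elimOr t u v => elimOr (subst σ t) (subst (liftSubst σ) u) (subst (liftSubst σ) v)

/-- The substitution that replaces variable `0` by `u` and decrements all other variables. -/
def single (u : Term S) : ℕ → Term S
  | 0 => u
  | n + 1 => var n

/-- `inst u t` is `(u/x)t`, where `x` is the variable of a binder whose body is `t`. -/
def inst (u t : Term S) : Term S := subst (single u) t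

end Term

/-- Contexts.  The `n`-th entry of the list is `some A` if the variable `n` is declared with
type `A`, and `none` if the variable `n` is not declared. -/
abbrev Ctx : Type := List (Option Proposition)

/-- No variable is declared in `Γ`. -/
def Ctx.IsEmpty (Γ : Ctx) : Prop := ∀ n : ℕ, ∀ A : Proposition, Γ[n]? ≠ some (some A)

/-- The context `Γ` consists of the single declaration `n : A`. -/
def Ctx.IsSingle (Γ : Ctx) (n : ℕ) (A : Proposition) : Prop :=
  Γ[n]? = some (some A) ∧ ∀ m : ℕ, ∀ B : Proposition, Γ[m]? = some (some B) → m = n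

/-- `Ctx.Split Θ Γ Δ` says that `Θ` is the disjoint union `Γ, Δ`: every declaration of `Θ` is in
exactly one of `Γ` and `Δ`, and these have no other declarations. -/
inductive Ctx.Split : Ctx → Ctx → Ctx → Prop
  | nil : Ctx.Split [] [] []
  | none {Θ Γ Δ : Ctx} : Ctx.Split Θ Γ Δ →
      Ctx.Split (Option.none :: Θ) (Option.none :: Γ) (Option.none :: Δ)
  | left {Θ Γ Δ : Ctx} (A : Proposition) : Ctx.Split Θ Γ Δ →
      Ctx.Split (some A :: Θ) (some A :: Γ) (Option.none :: Δ)
  | right {Θ Γ Δ : Ctx} (A : Proposition) : Ctx.Split Θ Γ Δ →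
      Ctx.Split (some A :: Θ) (Option.none :: Γ) (some A :: Δ)

open Proposition Term in
/-- The (linear) deduction rules: `HasType Γ t A` is the judgement `Γ ⊢ t : A`. -/
inductive HasType {S : Type*} : Ctx → Term S → Proposition → Prop
  | ax {Γ : Ctx} {n : ℕ} {A : Proposition} :
      Γ.IsSingle n A → HasType Γ (var n) A
  | sum {Γ : Ctx} {t u : Term S} {A : Proposition} :
      HasType Γ t A → HasType Γ u A → HasType Γ (plus t u) A
  | prod {Γ : Ctx} (a : S) {t : Term S} {A : Proposition} :
      HasType Γ t A → HasType Γ (smul a t) A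
  | topI {Γ : Ctx} (a : S) :
      Γ.IsEmpty → HasType Γ (star a) top
  | topE {Θ Γ Δ : Ctx} {t u : Term S} {A : Proposition} : Ctx.Split Θ Γ Δ →
      HasType Γ t top → HasType Δ u A → HasType Θ (elimTop t u) A
  | botE {Θ Γ Δ : Ctx} {t : Term S} {C : Proposition} : Ctx.Split Θ Γ Δ →
      HasType Γ t bot → HasType Θ (elimBot t) C
  | impI {Γ : Ctx} {t : Term S} {A B : Proposition} :
      HasType (some A :: Γ) t B → HasType Γ (lam t) (imp A B)
  | impE {Θ Γ Δ : Ctx} {t u : Term S} {A B : Proposition} : Ctx.Split Θ Γ Δ →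
      HasType Γ t (imp A B) → HasType Δ u A → HasType Θ (app t u) B
  | andI {Γ : Ctx} {t u : Term S} {A B : Proposition} :
      HasType Γ t A → HasType Γ u B → HasType Γ (pair t u) (and A B)
  | andE1 {Θ Γ Δ : Ctx} {t u : Term S} {A B C : Proposition} : Ctx.Split Θ Γ Δ →
      HasType Γ t (and A B) → HasType (some A :: Δ) u C → HasType Θ (elimAnd1 t u) C
  | andE2 {Θ Γ Δ : Ctx} {t u : Term S} {A B C : Proposition} : Ctx.Split Θ Γ Δ →
      HasType Γ t (and A B) → HasType (some B :: Δ) u C → HasType Θ (elimAnd2 t u) C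
  | orI1 {Γ : Ctx} {t : Term S} {A B : Proposition} :
      HasType Γ t A → HasType Γ (inl t) (or A B)
  | orI2 {Γ : Ctx} {t : Term S} {A B : Proposition} :
      HasType Γ t B → HasType Γ (inr t) (or A B)
  | orE {Θ Γ Δ : Ctx} {t u v : Term S} {A B C : Proposition} : Ctx.Split Θ Γ Δ →
      HasType Γ t (or A B) → HasType (some A :: Δ) u C → HasType (some B :: Δ) v C →
      HasType Θ (elimOr t u v) C

open Term in
/-- The fourteen reduction rules, applied at the root of a proof-term. -/
inductive RootStep {S : Type*} [Field S] : Term S → Term S → Prop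
  | elimTop_star (a : S) (t : Term S) :
      RootStep (elimTop (star a) t) (smul a t)
  | app_lam (t u : Term S) :
      RootStep (app (lam t) u) (inst u t)
  | elimAnd1_pair (t u v : Term S) :
      RootStep (elimAnd1 (pair t u) v) (inst t v)
  | elimAnd2_pair (t u v : Term S) :
      RootStep (elimAnd2 (pair t u) v) (inst u v)
  | elimOr_inl (t v w : Term S) :
      RootStep (elimOr (inl t) v w) (inst t v)
  | elimOr_inr (u v w : Term S) :
      RootStep (elimOr (inr u) v w) (inst u w)
  | plus_star (a b : S) :
      RootStep (plus (star a) (star b)) (star (a + b))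
  | plus_lam (t u : Term S) :
      RootStep (plus (lam t) (lam u)) (lam (plus t u))
  | plus_pair (t u v w : Term S) :
      RootStep (plus (pair t u) (pair v w)) (pair (plus t v) (plus u w))
  | elimOr_plus (t u v w : Term S) :
      RootStep (elimOr (plus t u) v w) (plus (elimOr t v w) (elimOr u v w))
  | smul_star (a b : S) :
      RootStep (smul a (star b)) (star (a * b))
  | smul_lam (a : S) (t : Term S) :
      RootStep (smul a (lam t)) (lam (smul a t))
  | smul_pair (a : S) (t u : Term S) :
      RootStep (smul a (pair t u)) (pair (smul a t) (smul a u))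
  | elimOr_smul (a : S) (t v w : Term S) :
      RootStep (elimOr (smul a t) v w) (smul a (elimOr t v w))

open Term in
/-- One-step reduction: a reduction rule applied to an arbitrary subterm, also below binders. -/
inductive Step {S : Type*} [Field S] : Term S → Term S → Prop
  | root {t t' : Term S} : RootStep t t' → Step t t'
  | plus_left {t t' : Term S} (u : Term S) : Step t t' → Step (plus t u) (plus t' u)
  | plus_right (t : Term S) {u u' : Term S} : Step u u' → Step (plus t u) (plus t u')
  | smul_arg (a : S) {t t' : Term S} : Step t t' → Step (smul a t) (smul a t')
  | elimTop_left {t t' : Term S} (u : Term S) : Step t t' → Step (elimTop t u) (elimTop t' u)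
  | elimTop_right (t : Term S) {u u' : Term S} : Step u u' → Step (elimTop t u) (elimTop t u')
  | elimBot_arg {t t' : Term S} : Step t t' → Step (elimBot t) (elimBot t')
  | lam_body {t t' : Term S} : Step t t' → Step (lam t) (lam t')
  | app_left {t t' : Term S} (u : Term S) : Step t t' → Step (app t u) (app t' u)
  | app_right (t : Term S) {u u' : Term S} : Step u u' → Step (app t u) (app t u')
  | pair_left {t t' : Term S} (u : Term S) : Step t t' → Step (pair t u) (pair t' u)
  | pair_right (t : Term S) {u u' : Term S} : Step u u' → Step (pair t u) (pair t u')
  | elimAnd1_left {t t' : Term S} (u : Term S) : Step t t' → Step (elimAnd1 t u) (elimAnd1 t' u)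
  | elimAnd1_right (t : Term S) {u u' : Term S} : Step u u' → Step (elimAnd1 t u) (elimAnd1 t u')
  | elimAnd2_left {t t' : Term S} (u : Term S) : Step t t' → Step (elimAnd2 t u) (elimAnd2 t' u)
  | elimAnd2_right (t : Term S) {u u' : Term S} : Step u u' → Step (elimAnd2 t u) (elimAnd2 t u')
  | inl_arg {t t' : Term S} : Step t t' → Step (inl t) (inl t')
  | inr_arg {t t' : Term S} : Step t t' → Step (inr t) (inr t')
  | elimOr_scrut {t t' : Term S} (u v : Term S) : Step t t' → Step (elimOr t u v) (elimOr t' u v)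
  | elimOr_left (t : Term S) {u u' : Term S} (v : Term S) :
      Step u u' → Step (elimOr t u v) (elimOr t u' v)
  | elimOr_right (t u : Term S) {v v' : Term S} :
      Step v v' → Step (elimOr t u v) (elimOr t u v')

/-- `t` is strongly normalizing: there is no infinite sequence of reduction steps from `t`. -/
def StronglyNormalizing {S : Type*} [Field S] (t : Term S) : Prop :=
  ¬ ∃ f : ℕ → Term S, f 0 = t ∧ ∀ n : ℕ, Step (f n) (f (n + 1))

end LSCalculus

/-! The proof is Tait's reducibility method. A term is reducible at `A` when its reductions all
terminate and every introduction they meet has the shape prescribed by `A`, with reducible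
components. The obstacle is the pair of rules that commute `elimOr` with `plus` and `smul`. Their
contracta eliminate `t` and `u` separately, but these need not be reducts of `plus t u`, so an
induction on the reductions of the scrutinee would not reach them. `UStep` repairs this by adding
the projections of a sum or a scalar multiple onto its arguments. Termination of this larger
relation implies termination of `Step`. Each constructor preserves reducibility; the cases that
carry the proof are `Red.plus`, `Red.smul` and `Red.elimOr`. Hence a typed term is reducible under
every reducible substitution (`HasType.red_subst`), in particular under the identity. -/

namespace LSCalculus

/-! ### Substitution calculus -/

namespace Term

variable {S : Type*}

/-- The substitution sending variable `0` to `u` and variable `n + 1` to `σ n`. -/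
def scons (u : Term S) (σ : ℕ → Term S) : ℕ → Term S
  | 0 => u
  | n + 1 => σ n

theorem liftRen_comp (ξ ζ : ℕ → ℕ) : liftRen ζ ∘ liftRen ξ = liftRen (ζ ∘ ξ) := by
  funext n; cases n <;> rfl

theorem rename_rename (t : Term S) (ξ ζ : ℕ → ℕ) :
    rename ζ (rename ξ t) = rename (ζ ∘ ξ) t := by
  induction t generalizing ξ ζ <;> simp_all [rename, liftRen_comp]

theorem liftSubst_comp_liftRen (ξ : ℕ → ℕ) (σ : ℕ → Term S) :
    liftSubst σ ∘ liftRen ξ = liftSubst (σ ∘ ξ) := by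
  funext n; cases n <;> rfl

theorem subst_rename (t : Term S) (ξ : ℕ → ℕ) (σ : ℕ → Term S) :
    subst σ (rename ξ t) = subst (σ ∘ ξ) t := by
  induction t generalizing ξ σ <;> simp_all [rename, subst, liftSubst_comp_liftRen]

theorem rename_comp_liftSubst (ξ : ℕ → ℕ) (σ : ℕ → Term S) :
    rename (liftRen ξ) ∘ liftSubst σ = liftSubst (rename ξ ∘ σ) := by
  funext n
  cases n with
  | zero => rfl
  | succ n => simp only [Function.comp_apply, liftSubst, rename_rename]; rfl

theorem rename_subst (t : Term S) (ξ : ℕ → ℕ) (σ : ℕ → Term S) :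
    rename ξ (subst σ t) = subst (rename ξ ∘ σ) t := by
  induction t generalizing ξ σ <;> simp_all [rename, subst, rename_comp_liftSubst]

theorem subst_comp_liftSubst (σ τ : ℕ → Term S) :
    subst (liftSubst τ) ∘ liftSubst σ = liftSubst (subst τ ∘ σ) := by
  funext n
  cases n with
  | zero => rfl
  | succ n => simp only [Function.comp_apply, liftSubst, rename_subst, subst_rename]; rfl

theorem subst_subst (t : Term S) (σ τ : ℕ → Term S) :
    subst τ (subst σ t) = subst (subst τ ∘ σ) t := by
  induction t generalizing σ τ <;> simp_all [subst, subst_comp_liftSubst]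

theorem liftSubst_var : liftSubst (var : ℕ → Term S) = var := by
  funext n; cases n <;> rfl

theorem subst_var (t : Term S) : subst var t = t := by
  induction t <;> simp_all [subst, liftSubst_var]

/-- Needed at binders: instantiating a substituted body is a single substitution, to which an
induction hypothesis quantified over substitutions applies. -/
theorem inst_subst_liftSubst (t u : Term S) (σ : ℕ → Term S) :
    inst u (subst (liftSubst σ) t) = subst (scons u σ) t := by
  rw [inst, subst_subst]
  congr 1
  funext n
  cases n with
  | zero => rfl
  | succ n =>
    simp only [Function.comp_apply, liftSubst, subst_rename, scons]
    exact subst_var _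

theorem subst_inst (t u : Term S) (σ : ℕ → Term S) :
    subst σ (inst u t) = inst (subst σ u) (subst (liftSubst σ) t) := by
  rw [inst_subst_liftSubst, inst, subst_subst]
  congr 1
  funext n
  cases n <;> rfl

/-- The introduction forms. -/
def IsIntro : Term S → Prop
  | star _ | lam _ | pair _ _ | inl _ | inr _ => True
  | _ => False

end Term

/-! ### Reduction extended with projections -/

open Term

variable {S : Type*} [Field S]

/-- Reduction extended with the projections `t + u ⟶ t`, `t + u ⟶ u` and `a • t ⟶ t`. -/
inductive UStep : Term S → Term S → Prop
  | plus_fst (t u : Term S) : UStep (plus t u) t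
  | plus_snd (t u : Term S) : UStep (plus t u) u
  | smul_drop (a : S) (t : Term S) : UStep (smul a t) t
  | plus_left {t t' : Term S} (u : Term S) : UStep t t' → UStep (plus t u) (plus t' u)
  | plus_right (t : Term S) {u u' : Term S} : UStep u u' → UStep (plus t u) (plus t u')
  | smul_arg (a : S) {t t' : Term S} : UStep t t' → UStep (smul a t) (smul a t')
  | elimTop_left {t t' : Term S} (u : Term S) : UStep t t' → UStep (elimTop t u) (elimTop t' u)
  | elimTop_right (t : Term S) {u u' : Term S} : UStep u u' → UStep (elimTop t u) (elimTop t u')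
  | elimBot_arg {t t' : Term S} : UStep t t' → UStep (elimBot t) (elimBot t')
  | lam_body {t t' : Term S} : UStep t t' → UStep (lam t) (lam t')
  | app_left {t t' : Term S} (u : Term S) : UStep t t' → UStep (app t u) (app t' u)
  | app_right (t : Term S) {u u' : Term S} : UStep u u' → UStep (app t u) (app t u')
  | pair_left {t t' : Term S} (u : Term S) : UStep t t' → UStep (pair t u) (pair t' u)
  | pair_right (t : Term S) {u u' : Term S} : UStep u u' → UStep (pair t u) (pair t u')
  | elimAnd1_left {t t' : Term S} (u : Term S) :
      UStep t t' → UStep (elimAnd1 t u) (elimAnd1 t' u)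
  | elimAnd1_right (t : Term S) {u u' : Term S} :
      UStep u u' → UStep (elimAnd1 t u) (elimAnd1 t u')
  | elimAnd2_left {t t' : Term S} (u : Term S) :
      UStep t t' → UStep (elimAnd2 t u) (elimAnd2 t' u)
  | elimAnd2_right (t : Term S) {u u' : Term S} :
      UStep u u' → UStep (elimAnd2 t u) (elimAnd2 t u')
  | inl_arg {t t' : Term S} : UStep t t' → UStep (inl t) (inl t')
  | inr_arg {t t' : Term S} : UStep t t' → UStep (inr t) (inr t')
  | elimOr_scrut {t t' : Term S} (u v : Term S) :
      UStep t t' → UStep (elimOr t u v) (elimOr t' u v)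
  | elimOr_left (t : Term S) {u u' : Term S} (v : Term S) :
      UStep u u' → UStep (elimOr t u v) (elimOr t u' v)
  | elimOr_right (t u : Term S) {v v' : Term S} :
      UStep v v' → UStep (elimOr t u v) (elimOr t u v')
  | root {t t' : Term S} : RootStep t t' → UStep t t'

theorem Step.toUStep {t t' : Term S} (h : Step t t') : UStep t t' := by
  induction h <;> constructor <;> assumption

theorem RootStep.subst {t t' : Term S} (h : RootStep t t') (σ : ℕ → Term S) :
    RootStep (t.subst σ) (t'.subst σ) := by
  cases h <;> (try rw [subst_inst]) <;> constructor

theorem UStep.subst {t t' : Term S} (h : UStep t t') (σ : ℕ → Term S) :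
    UStep (t.subst σ) (t'.subst σ) := by
  induction h generalizing σ with
  | root h => exact .root (h.subst σ)
  | plus_fst => exact .plus_fst _ _
  | plus_snd => exact .plus_snd _ _
  | smul_drop => exact .smul_drop _ _
  | _ => constructor; solve_by_elim

/-- Accessibility for the extended reduction. -/
abbrev SN (t : Term S) : Prop := Acc (fun t' t => UStep t t') t

/-- Substitution maps each step from `t` to exactly one step, so an infinite reduction of `t` would
give one of its instance. -/
theorem SN.of_subst {t : Term S} {σ : ℕ → Term S} (h : SN (t.subst σ)) : SN t :=
  Subrelation.accessible (r := InvImage (fun t' t => UStep t t') (Term.subst σ))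
    (fun h => UStep.subst h σ) (InvImage.accessible _ h)

theorem SN.stronglyNormalizing {t : Term S} (h : SN t) : StronglyNormalizing t := by
  induction h with
  | intro t _ ih =>
    rintro ⟨f, rfl, hf⟩
    exact ih (f 1) (hf 0).toUStep ⟨fun n => f (n + 1), rfl, fun n => hf (n + 1)⟩

/-! ### Reducibility -/

/-- The terms all of whose reduction sequences are finite and meet only introductions
satisfying `P`. -/
inductive Candidate (P : Term S → Prop) : Term S → Prop
  | intro (t : Term S) : (t.IsIntro → P t) → (∀ t', UStep t t' → Candidate P t') → Candidate P t

namespace Candidate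

variable {P : Term S → Prop} {t t' : Term S}

theorem step (h : Candidate P t) (s : UStep t t') : Candidate P t' := by
  cases h with
  | intro _ _ h => exact h _ s

theorem val (h : Candidate P t) (hi : t.IsIntro) : P t := by
  cases h with
  | intro _ h _ => exact h hi

theorem sn (h : Candidate P t) : SN t := by
  induction h with
  | intro t _ _ ih => exact ⟨t, ih⟩

end Candidate

/-- The immediate subpropositions of an implication or a conjunction satisfy `P`. -/
def Proposition.Hereditary (P : Proposition → Prop) (A : Proposition) : Prop :=
  ∀ B C, A = .imp B C ∨ A = .and B C → P B ∧ P C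

/-- Leaves a single case, so that the shape of `A` can be read off later from the root rule that
fires. Disjunctions need no hypothesis, since no rule pushes `plus` or `smul` inside `inl` or `inr`.
-/
theorem Proposition.hereditary_induction {P : Proposition → Prop}
    (h : ∀ A, A.Hereditary P → P A) (A : Proposition) : P A := by
  induction A with
  | imp B C hB hC | and B C hB hC => exact h _ fun _ _ e => by cases e <;> simp_all
  | _ => exact h _ fun _ _ e => by simp at e

/-- The reducible terms of a proposition. -/
def Red : Proposition → Term S → Prop
  | .top => Candidate fun t => ∃ a, t = star a
  | .bot => Candidate fun _ => False
  | .imp A B => Candidate fun t => ∃ u, t = lam u ∧ ∀ v, Red A v → Red B (inst v u)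
  | .and A B => Candidate fun t => ∃ u v, t = pair u v ∧ Red A u ∧ Red B v
  | .or A B => Candidate fun t => (∃ u, t = inl u ∧ Red A u) ∨ ∃ u, t = inr u ∧ Red B u

/-! ### Closure of reducibility under the term constructors -/

namespace Red

variable {A B C : Proposition} {t t' u w : Term S} {a : S}

theorem step (h : Red A t) (s : UStep t t') : Red A t' := by
  cases A <;> exact Candidate.step h s

theorem sn (h : Red A t) : SN t := by
  cases A <;> exact Candidate.sn h

/-- The condition on introductions is vacuous here. This reduces `plus`, `smul` and every
elimination to an inspection of one-step reducts. -/
theorem of_steps (hi : ¬ t.IsIntro) (h : ∀ t', UStep t t' → Red A t') : Red A t := by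
  cases A <;> exact ⟨t, fun k => (hi k).elim, h⟩

theorem var (n : ℕ) : Red A (Term.var n : Term S) :=
  -- `id` suffices because `IsIntro` of a variable unfolds to `False`.
  of_steps id fun _ h => by cases h with | root h => cases h

theorem star : Red .top (Term.star a) :=
  ⟨_, fun _ => ⟨a, rfl⟩, fun _ h => by cases h with | root h => cases h⟩

theorem star_prop (h : Red A (Term.star a)) : A = .top := by
  cases A with
  | top => rfl
  | bot => exact (Candidate.val h trivial).elim
  | _ => simpa using Candidate.val h trivial

theorem lam_prop (h : Red A (Term.lam t)) :
    ∃ B C, A = .imp B C ∧ ∀ v, Red B v → Red C (inst v t) := by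
  cases A with
  | imp B C => exact ⟨B, C, rfl, by simpa using Candidate.val h trivial⟩
  | bot => exact (Candidate.val h trivial).elim
  | _ => simpa using Candidate.val h trivial

theorem pair_prop (h : Red A (Term.pair t u)) : ∃ B C, A = .and B C ∧ Red B t ∧ Red C u := by
  cases A with
  | and B C => exact ⟨B, C, rfl, by simpa using Candidate.val h trivial⟩
  | bot => exact (Candidate.val h trivial).elim
  | _ => simpa using Candidate.val h trivial

theorem inl_arg (h : Red (.or A B) (Term.inl t)) : Red A t := by
  simpa using Candidate.val h trivial

theorem inr_arg (h : Red (.or A B) (Term.inr t)) : Red B t := by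
  simpa using Candidate.val h trivial

/-- Variables are reducible, so some instance of the body is reducible, hence terminating, and
substitution reflects termination. -/
theorem sn_body (h : ∀ v, Red A v → Red B (inst v t)) : SN t :=
  (h _ (var 0)).sn.of_subst

/-- By induction on the reductions of the body: the hypothesis survives a step because steps are
stable under substitution. -/
theorem lam (h : ∀ v, Red A v → Red B (inst v t)) : Red (.imp A B) (Term.lam t) := by
  induction sn_body h with
  | intro t _ ih =>
    refine ⟨_, fun _ => ⟨t, rfl, h⟩, fun t' s => ?_⟩
    cases s with
    | root s => cases s
    | lam_body s => exact ih _ s fun v hv => (h v hv).step (s.subst _)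

theorem pair (ht : Red A t) (hu : Red B u) : Red (.and A B) (Term.pair t u) := by
  induction ht.sn generalizing u with
  | intro t _ iht =>
    induction hu.sn with
    | intro u _ ihu =>
      refine ⟨_, fun _ => ⟨t, u, rfl, ht, hu⟩, fun t' s => ?_⟩
      cases s with
      | root s => cases s
      | pair_left _ s => exact iht _ s (ht.step s) hu
      | pair_right _ s => exact ihu _ s (hu.step s)

theorem inl (ht : Red A t) : Red (.or A B) (Term.inl t) := by
  induction ht.sn with
  | intro t _ ih =>
    refine ⟨_, fun _ => .inl ⟨t, rfl, ht⟩, fun t' s => ?_⟩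
    cases s with
    | root s => cases s
    | inl_arg s => exact ih _ s (ht.step s)

theorem inr (ht : Red B t) : Red (.or A B) (Term.inr t) := by
  induction ht.sn with
  | intro t _ ih =>
    refine ⟨_, fun _ => .inr ⟨t, rfl, ht⟩, fun t' s => ?_⟩
    cases s with
    | root s => cases s
    | inr_arg s => exact ih _ s (ht.step s)

/-- Lexicographic induction on `A`, the reductions of `t` and those of `u`. Projections return to
`t` or `u`; a root rule on abstractions or pairs creates sums at smaller propositions. -/
theorem plus (ht : Red A t) (hu : Red A u) : Red A (Term.plus t u) := by
  induction A using Proposition.hereditary_induction generalizing t u with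
  | h A ih =>
  induction ht.sn generalizing u with
  | intro t _ iht =>
  induction hu.sn with
  | intro u _ ihu =>
  refine of_steps id fun t' s => ?_
  cases s with
  | plus_fst => exact ht
  | plus_snd => exact hu
  | plus_left _ s => exact iht _ s (ht.step s) hu
  | plus_right _ s => exact ihu _ s (hu.step s)
  | root s =>
    cases s with
    | plus_star => cases ht.star_prop; exact star
    | plus_lam =>
      obtain ⟨B, C, rfl, ht'⟩ := ht.lam_prop
      obtain ⟨_, _, ⟨⟩, hu'⟩ := hu.lam_prop
      -- By definition, `inst v` distributes over `plus`.
      exact lam fun v hv => (ih B C (.inl rfl)).2 (ht' v hv) (hu' v hv)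
    | plus_pair =>
      obtain ⟨B, C, rfl, ht'⟩ := ht.pair_prop
      obtain ⟨_, _, ⟨⟩, hu'⟩ := hu.pair_prop
      have ih := ih B C (.inr rfl)
      exact pair (ih.1 ht'.1 hu'.1) (ih.2 ht'.2 hu'.2)

theorem smul (ht : Red A t) : Red A (Term.smul a t) := by
  induction A using Proposition.hereditary_induction generalizing t with
  | h A ih =>
  induction ht.sn with
  | intro t _ iht =>
  refine of_steps id fun t' s => ?_
  cases s with
  | smul_drop => exact ht
  | smul_arg _ s => exact iht _ s (ht.step s)
  | root s =>
    cases s with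
    | smul_star => cases ht.star_prop; exact star
    | smul_lam =>
      obtain ⟨B, C, rfl, ht'⟩ := ht.lam_prop
      exact lam fun v hv => (ih B C (.inl rfl)).2 (ht' v hv)
    | smul_pair =>
      obtain ⟨B, C, rfl, ht'⟩ := ht.pair_prop
      have ih := ih B C (.inr rfl)
      exact pair (ih.1 ht'.1) (ih.2 ht'.2)

theorem elimTop (ht : Red .top t) (hu : Red A u) : Red A (Term.elimTop t u) := by
  induction ht.sn generalizing u with
  | intro t _ iht =>
  induction hu.sn with
  | intro u _ ihu =>
  refine of_steps id fun t' s => ?_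
  cases s with
  | elimTop_left _ s => exact iht _ s (ht.step s) hu
  | elimTop_right _ s => exact ihu _ s (hu.step s)
  | root s => cases s; exact smul hu

theorem elimBot (ht : Red .bot t) : Red A (Term.elimBot t) := by
  induction ht.sn with
  | intro t _ iht =>
  refine of_steps id fun t' s => ?_
  cases s with
  | root s => cases s
  | elimBot_arg s => exact iht _ s (ht.step s)

theorem app (ht : Red (.imp A B) t) (hu : Red A u) : Red B (Term.app t u) := by
  induction ht.sn generalizing u with
  | intro t _ iht =>
  induction hu.sn with
  | intro u _ ihu =>
  refine of_steps id fun t' s => ?_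
  cases s with
  | app_left _ s => exact iht _ s (ht.step s) hu
  | app_right _ s => exact ihu _ s (hu.step s)
  | root s =>
    cases s
    obtain ⟨_, _, h, ht⟩ := ht.lam_prop
    cases h
    exact ht _ hu

theorem elimAnd1 (ht : Red (.and A B) t) (hu : ∀ v, Red A v → Red C (inst v u)) :
    Red C (Term.elimAnd1 t u) := by
  induction ht.sn generalizing u with
  | intro t _ iht =>
  induction sn_body hu with
  | intro u _ ihu =>
  refine of_steps id fun t' s => ?_
  cases s with
  | elimAnd1_left _ s => exact iht _ s (ht.step s) hu
  | elimAnd1_right _ s => exact ihu _ s fun v hv => (hu v hv).step (s.subst _)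
  | root s =>
    cases s
    obtain ⟨_, _, h, ht⟩ := ht.pair_prop
    cases h
    exact hu _ ht.1

theorem elimAnd2 (ht : Red (.and A B) t) (hu : ∀ v, Red B v → Red C (inst v u)) :
    Red C (Term.elimAnd2 t u) := by
  induction ht.sn generalizing u with
  | intro t _ iht =>
  induction sn_body hu with
  | intro u _ ihu =>
  refine of_steps id fun t' s => ?_
  cases s with
  | elimAnd2_left _ s => exact iht _ s (ht.step s) hu
  | elimAnd2_right _ s => exact ihu _ s fun v hv => (hu v hv).step (s.subst _)
  | root s =>
    cases s
    obtain ⟨_, _, h, ht⟩ := ht.pair_prop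
    cases h
    exact hu _ ht.2

/-- Nested induction on the reductions of the scrutinee and of both branches; the projections of
`UStep` serve precisely here. -/
theorem elimOr (ht : Red (.or A B) t) (hu : ∀ v, Red A v → Red C (inst v u))
    (hw : ∀ v, Red B v → Red C (inst v w)) : Red C (Term.elimOr t u w) := by
  induction ht.sn generalizing u w with
  | intro t _ iht =>
  induction sn_body hu generalizing w with
  | intro u _ ihu =>
  induction sn_body hw with
  | intro w _ ihw =>
  refine of_steps id fun t' s => ?_
  cases s with
  | elimOr_scrut _ _ s => exact iht _ s (ht.step s) hu hw
  | elimOr_left _ _ s => exact ihu _ s (fun v hv => (hu v hv).step (s.subst _)) hw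
  | elimOr_right _ _ s => exact ihw _ s fun v hv => (hw v hv).step (s.subst _)
  | root s =>
    -- In the commuting rules, the summands or the scaled term are reducts of the scrutinee by
    -- projection, so the outer induction hypothesis covers them.
    have proj {t'} (s : UStep t t') : Red C (Term.elimOr t' u w) := iht _ s (ht.step s) hu hw
    cases s with
    | elimOr_inl => exact hu _ ht.inl_arg
    | elimOr_inr => exact hw _ ht.inr_arg
    | elimOr_plus => exact plus (proj (.plus_fst _ _)) (proj (.plus_snd _ _))
    | elimOr_smul => exact smul (proj (.smul_drop _ _))

end Red

/-! ### Typed terms are reducible under reducible substitutions -/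

/-- `σ` sends each variable declared in `Γ` to a reducible term of its proposition. -/
def RedSubst (Γ : Ctx) (σ : ℕ → Term S) : Prop :=
  ∀ (n : ℕ) (A : Proposition), Γ[n]? = some (some A) → Red A (σ n)

namespace RedSubst

variable {Γ : Ctx} {σ : ℕ → Term S}

theorem scons {A : Proposition} {v : Term S} (h : RedSubst Γ σ) (hv : Red A v) :
    RedSubst (some A :: Γ) (Term.scons v σ)
  | 0, B, hB => by simp at hB; exact hB ▸ hv
  | n + 1, B, hB => h n B (by simpa using hB)

theorem inst_body {A B : Proposition} {t v : Term S}
    (ih : ∀ τ : ℕ → Term S, RedSubst (some A :: Γ) τ → Red B (t.subst τ))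
    (h : RedSubst Γ σ) (hv : Red A v) : Red B (inst v (t.subst (liftSubst σ))) :=
  inst_subst_liftSubst t v σ ▸ ih _ (h.scons hv)

end RedSubst

theorem Ctx.Split.getElem?_left {Θ Γ Δ : Ctx} (h : Ctx.Split Θ Γ Δ) {n : ℕ} {A : Proposition}
    (hA : Γ[n]? = some (some A)) : Θ[n]? = some (some A) := by
  induction h generalizing n with
  | nil => exact hA
  | _ => cases n <;> simp_all

theorem Ctx.Split.getElem?_right {Θ Γ Δ : Ctx} (h : Ctx.Split Θ Γ Δ) {n : ℕ} {A : Proposition}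
    (hA : Δ[n]? = some (some A)) : Θ[n]? = some (some A) := by
  induction h generalizing n with
  | nil => exact hA
  | _ => cases n <;> simp_all

theorem RedSubst.left {Θ Γ Δ : Ctx} {σ : ℕ → Term S} (h : RedSubst Θ σ) (s : Ctx.Split Θ Γ Δ) :
    RedSubst Γ σ := fun n A hA => h n A (s.getElem?_left hA)

theorem RedSubst.right {Θ Γ Δ : Ctx} {σ : ℕ → Term S} (h : RedSubst Θ σ) (s : Ctx.Split Θ Γ Δ) :
    RedSubst Δ σ := fun n A hA => h n A (s.getElem?_right hA)

/-- Quantifying over `σ` lets the induction pass under binders, where `σ` is extended by an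
arbitrary reducible term. -/
theorem HasType.red_subst {Γ : Ctx} {t : Term S} {A : Proposition} (ht : HasType Γ t A)
    (σ : ℕ → Term S) (h : RedSubst Γ σ) : Red A (t.subst σ) := by
  induction ht generalizing σ with
  | ax hs => exact h _ _ hs.1
  | sum _ _ iht ihu => exact (iht σ h).plus (ihu σ h)
  | prod _ _ iht => exact (iht σ h).smul
  | topI => exact .star
  | topE s _ _ iht ihu => exact (iht σ (h.left s)).elimTop (ihu σ (h.right s))
  | botE s _ iht => exact (iht σ (h.left s)).elimBot
  | impI _ iht => exact .lam fun _ => RedSubst.inst_body iht h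
  | impE s _ _ iht ihu => exact (iht σ (h.left s)).app (ihu σ (h.right s))
  | andI _ _ iht ihu => exact (iht σ h).pair (ihu σ h)
  | andE1 s _ _ iht ihu =>
    exact (iht σ (h.left s)).elimAnd1 fun _ => RedSubst.inst_body ihu (h.right s)
  | andE2 s _ _ iht ihu =>
    exact (iht σ (h.left s)).elimAnd2 fun _ => RedSubst.inst_body ihu (h.right s)
  | orI1 _ iht => exact (iht σ h).inl
  | orI2 _ iht => exact (iht σ h).inr
  | orE s _ _ _ iht ihu ihv =>
    exact (iht σ (h.left s)).elimOr (fun _ => RedSubst.inst_body ihu (h.right s))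
      fun _ => RedSubst.inst_body ihv (h.right s)

end LSCalculus

theorem mainTheorem6 {S : Type*} [Field S] (Γ : LSCalculus.Ctx) (t : LSCalculus.Term S)
    (A : LSCalculus.Proposition) (ht : LSCalculus.HasType Γ t A) :
    LSCalculus.StronglyNormalizing t :=
  -- The identity substitution is reducible because variables are.
  (ht.red_subst LSCalculus.Term.var fun n _ _ => .var n).sn.of_subst.stronglyNormalizing
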